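/- Notation. For directed partially ordered sets $P,Q$ write $Q\le_T P$ if there is a map $\phi:P\to Q$ (a Tukey quotient) that takes every cofinal subset of $P$ to a cofinal subset of $Q$, and write $Q<_T P$ if $Q\le_T P$ but $P\not\le_T Q$. Products carry the coordinatewise order; $\omega_1$ is the set of countable ordinals with its usual order and order topology; $\omega^\omega$ is the set of functions $\omega\to\omega$ ordered coordinatewise; $[\omega_1]^{<\omega}$ is the set of finite subsets of $\omega_1$ ordered by inclusion; $\Sigma(\omega^{\omega_1})$ is the set of functions $\omega_1\to\omega$ that are eventually constantly $0$, ordered coordinatewise. For $S\subseteq\omega_1$, $\mathcal K(S)$ is the set of compact subsets of the subspace $S$ of $\omega_1$, ordered by inclusion. A set $S\subseteq\omega_1$ is stationary if it meets every closed unbounded subset of $\omega_1$, and co-stationary if $\omega_1\setminus S$ is stationary. $\mathfrak b$ and $\mathfrak d$ are the least cardinalities of an unbounded, respectively a cofinal (dominating), family in $\omega^\omega$ with respect to eventual dominance ($f\le^* g$ iff $f(n)\le g(n)$ for all but finitely many $n$). Lemma. (a) $\omega_1\times\omega<_T\omega_1\times\omega^\omega$. (b) $\omega\times\omega_1<_T[\omega_1]^{<\omega}$.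 (c) $\omega^\omega\not\le_T\omega_1\times\omega$; and $\omega_1\times\omega<_T\omega^\omega$ if and only if $\omega_1=\mathfrak b$. (d) $[\omega_1]^{<\omega}\not\le_T\omega_1\times\omega^\omega$; and $\omega_1\times\omega^\omega<_T[\omega_1]^{<\omega}$ if and only if $\omega_1=\mathfrak d$. (e) $\omega_1\times\omega^\omega\le_T\Sigma(\omega^{\omega_1})<_T[\omega_1]^{<\omega}\times\omega^\omega$. (f) If $S\subseteq\omega_1$ is stationary and co-stationary, then $\omega_1\times\omega^\omega<_T\mathcal K(S)<_T[\omega_1]^{<\omega}\times\omega^\omega$. (g) If $S\subseteq\omega_1$ is stationary and co-stationary, then $\mathcal K(S)\not\le_T\Sigma(\omega^{\omega_1})$. -/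

import Mathlib

open scoped Ordinal Cardinal

universe u v

/-- `φ` is a Tukey quotient: it carries cofinal subsets of `P` to cofinal subsets of `Q`. -/
def IsTukeyQuotient {P : Type u} {Q : Type v} [PartialOrder P] [PartialOrder Q]
    (φ : P → Q) : Prop :=
  ∀ C : Set P, IsCofinal C → IsCofinal (φ '' C)

/-- `Q ≤_T P`: `Q` is a Tukey quotient of `P`. -/
def TukeyLE (Q : Type v) (P : Type u) [PartialOrder Q] [PartialOrder P] : Prop :=
  ∃ φ : P → Q, IsTukeyQuotient φ

/-- `Q <_T P`: `Q` is a Tukey quotient of `P`, but not conversely. -/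
def TukeyLT (Q : Type v) (P : Type u) [PartialOrder Q] [PartialOrder P] : Prop :=
  TukeyLE Q P ∧ ¬ TukeyLE P Q

infix:30 " ≤ₜ " => TukeyLE
infix:30 " <ₜ " => TukeyLT

/-- The space `ω₁` of all countable ordinals, with its usual order and the order topology
(inherited from the order topology on the ordinals). -/
abbrev Omega1 : Type 1 := Set.Iio (ω₁ : Ordinal.{0})

/-- The poset `ω^ω`, ordered coordinatewise. -/
abbrev OmegaOmega : Type := ℕ → ℕ

/-- The poset `[ω₁]^{<ω}` of finite subsets of `ω₁`, ordered by inclusion. -/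
abbrev FinOmega1 : Type 1 := Finset Omega1

/-- The poset `Σ(ω^{ω₁})` of all functions `ω₁ → ω` that are eventually constantly `0`,
ordered coordinatewise. -/
abbrev SigmaOmega1 : Type 1 := {f : Omega1 → ℕ // ∃ α, ∀ β, α ≤ β → f β = 0}

/-- The poset `𝒦(S)` of compact subsets of the subspace `S` of `ω₁`, ordered by inclusion. -/
abbrev KOmega1 (S : Set Omega1) : Type 1 := TopologicalSpace.Compacts S

/-- Eventual dominance on `ω^ω`: `f n ≤ g n` for all but finitely many `n`. -/
def EvLE (f g : OmegaOmega) : Prop := ∀ᶠ n in Filter.atTop, f n ≤ g n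

/-- The bounding number `𝔟`: the least size of a family in `ω^ω` that is unbounded under
eventual dominance. -/
noncomputable def boundingNumber : Cardinal.{0} :=
  sInf {κ | ∃ B : Set OmegaOmega, (¬ ∃ g, ∀ f ∈ B, EvLE f g) ∧ Cardinal.mk B = κ}

/-- The dominating number `𝔡`: the least size of a family in `ω^ω` that is cofinal under
eventual dominance. -/
noncomputable def dominatingNumber : Cardinal.{0} :=
  sInf {κ | ∃ D : Set OmegaOmega, (∀ f, ∃ g ∈ D, EvLE f g) ∧ Cardinal.mk D = κ}

theorem tukeyLE_iff {P : Type*} {Q : Type*} [PartialOrder P] [PartialOrder Q] :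
    (Q ≤ₜ P) ↔ ∃ (φ : P → Q) (ψ : Q → P), ∀ q p, ψ q ≤ p → q ≤ φ p := by
  constructor
  · rintro ⟨φ, hφ⟩
    have h : ∀ q, ∃ p₀, ∀ p, p₀ ≤ p → q ≤ φ p := by
      intro q
      by_contra! hq
      -- If `q` has no threshold, this set is cofinal, yet its image contains nothing above `q`.
      obtain ⟨_, ⟨p, hp, rfl⟩, hle⟩ := hφ {p | ¬ q ≤ φ p}
        (fun p₀ => (hq p₀).imp fun p h => ⟨h.2, h.1⟩) q
      exact hp hle
    choose ψ hψ using h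
    exact ⟨φ, ψ, hψ⟩
  · rintro ⟨φ, ψ, h⟩
    refine ⟨φ, fun C hC q => ?_⟩
    obtain ⟨p, hp, hle⟩ := hC (ψ q)
    exact ⟨φ p, ⟨p, hp, rfl⟩, h q p hle⟩

/-- A map whose preimages of principal lower sets are bounded witnesses a Tukey reduction. -/
theorem TukeyLE.of_bdd {P : Type*} {Q : Type*} [PartialOrder P] [PartialOrder Q] (ψ : Q → P)
    (h : ∀ p, ∃ q', ∀ q, ψ q ≤ p → q ≤ q') : Q ≤ₜ P := by
  choose φ hφ using h
  exact tukeyLE_iff.2 ⟨φ, ψ, fun q p => hφ p q⟩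

theorem TukeyLE.exists_bdd {P : Type*} {Q : Type*} [PartialOrder P] [PartialOrder Q]
    (h : Q ≤ₜ P) : ∃ ψ : Q → P, ∀ p, ∃ q', ∀ q, ψ q ≤ p → q ≤ q' := by
  obtain ⟨φ, ψ, h⟩ := tukeyLE_iff.1 h
  exact ⟨ψ, fun p => ⟨φ p, fun q => h q p⟩⟩

theorem TukeyLE.trans {P Q R : Type*} [PartialOrder P] [PartialOrder Q] [PartialOrder R]
    (h₁ : R ≤ₜ Q) (h₂ : Q ≤ₜ P) : R ≤ₜ P := by
  obtain ⟨φ, hφ⟩ := h₁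
  obtain ⟨χ, hχ⟩ := h₂
  refine ⟨φ ∘ χ, fun C hC => ?_⟩
  rw [Set.image_comp]
  exact hφ _ (hχ _ hC)

theorem TukeyLE.fst {P Q : Type*} [PartialOrder P] [PartialOrder Q] [Nonempty Q] : P ≤ₜ P × Q :=
  .of_bdd (fun p => (p, Classical.arbitrary Q)) fun p => ⟨p.1, fun _ h => h.1⟩

theorem TukeyLE.snd {P Q : Type*} [PartialOrder P] [PartialOrder Q] [Nonempty P] : Q ≤ₜ P × Q :=
  .of_bdd (fun q => (Classical.arbitrary P, q)) fun p => ⟨p.2, fun _ h => h.2⟩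

/-! ### Countable boundedness, clubs and reflection in `ω₁`. -/

namespace Omega1

theorem cof_eq : Order.cof Omega1 = ℵ₁ := by
  rw [Ordinal.cof_Iio]
  simp

theorem mk_eq : Cardinal.mk Omega1 = ℵ₁ := by
  rw [Cardinal.mk_Iio_ordinal]
  simp

instance : Nonempty Omega1 := ⟨⟨0, Ordinal.omega_pos 1⟩⟩

instance : Infinite Omega1 := Cardinal.infinite_iff.2 (by rw [mk_eq]; simp)

theorem bddAbove_of_countable {s : Set Omega1} (hs : s.Countable) : BddAbove s := by
  refine .of_not_isCofinal fun h => ?_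
  have := Order.cof_le h
  rw [cof_eq] at this
  exact (this.trans hs.le_aleph0).not_gt Cardinal.aleph0_lt_aleph_one

instance : NoMaxOrder Omega1 := by
  refine ⟨fun a => ⟨⟨Order.succ a.1, ?_⟩, ?_⟩⟩
  · exact (Cardinal.isSuccLimit_omega 1).succ_lt a.2
  · exact Order.lt_succ a.1

theorem exists_forall_lt {s : Set Omega1} (hs : s.Countable) : ∃ b, ∀ a ∈ s, a < b := by
  obtain ⟨b, hb⟩ := bddAbove_of_countable hs
  obtain ⟨c, hc⟩ := exists_gt b
  exact ⟨c, fun a ha => (hb ha).trans_lt hc⟩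

theorem countable_Iio (a : Omega1) : (Set.Iio a).Countable := by
  have h : (Set.Iio a.1).Countable := by
    rw [← Cardinal.le_aleph0_iff_set_countable, Cardinal.mk_Iio_ordinal, Cardinal.lift_le_aleph0,
      ← Order.lt_succ_iff, Cardinal.succ_aleph0]
    have := Cardinal.lt_ord.1 (a.2.trans_eq (Cardinal.ord_aleph 1).symm)
    exact this
  exact (h.preimage Subtype.val_injective).mono fun x hx => hx

theorem countable_Iic (a : Omega1) : (Set.Iic a).Countable := by
  obtain ⟨b, hb⟩ := exists_gt a
  exact (countable_Iio b).mono fun x hx => lt_of_le_of_lt hx hb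

/-- A simultaneous choice of enumerations of the initial segments of `ω₁`. -/
theorem exists_enum : ∃ (e : Omega1 → ℕ → Omega1) (c : Omega1 → Omega1 → ℕ),
    ∀ α, ∀ y ≤ α, e α (c α y) = y := by
  have h : ∀ α : Omega1, ∃ e : ℕ → Omega1, Set.Iic α = Set.range e := fun α =>
    (countable_Iic α).exists_eq_range ⟨α, Set.mem_Iic.2 le_rfl⟩
  choose e he using h
  have h' : ∀ α y : Omega1, ∃ n, y ≤ α → e α n = y := by
    intro α y
    by_cases hy : y ≤ α
    · have : y ∈ Set.Iic α := hy
      rw [he] at this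
      exact this.imp fun n hn _ => hn
    · exact ⟨0, fun h => absurd h hy⟩
  choose c hc using h'
  exact ⟨e, c, hc⟩

/-- A club of points closed under a given function. -/
theorem exists_isClub_closed (G : Omega1 → Omega1) :
    ∃ C : Set Omega1, IsClub C ∧ ∀ δ ∈ C, (∃ γ, γ < δ) ∧ ∀ γ < δ, G γ < δ := by
  refine ⟨{δ | (∃ γ, γ < δ) ∧ ∀ γ < δ, G γ < δ}, ⟨?_, ?_⟩, fun δ h => h⟩
  · intro d hd hne _ a ha
    constructor
    · obtain ⟨x, hx⟩ := hne
      obtain ⟨γ, hγ⟩ := (hd hx).1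
      exact ⟨γ, hγ.trans_le (ha.1 hx)⟩
    · intro γ hγ
      obtain ⟨x, hx, hlt⟩ := (lt_isLUB_iff ha).1 hγ
      exact ((hd hx).2 γ hlt).trans_le (ha.1 hx)
  · intro a
    have h : ∀ γ, ∃ b, γ < b ∧ ∀ x ≤ γ, G x < b := by
      intro γ
      obtain ⟨b, hb⟩ := exists_forall_lt
        (((countable_Iic γ).image G).union (Set.countable_singleton γ))
      exact ⟨b, hb _ (Or.inr rfl), fun x hx => hb _ (Or.inl ⟨x, hx, rfl⟩)⟩
    choose M hM₁ hM₂ using h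
    let s : ℕ → Omega1 := fun n => M^[n] a
    have hs : ∀ n, s (n + 1) = M (s n) := fun n => Function.iterate_succ_apply' M n a
    obtain ⟨δ, hδ, hmin⟩ := WellFounded.has_min (wellFounded_lt (α := Omega1))
      (upperBounds (Set.range s)) (bddAbove_of_countable (Set.countable_range s))
    have hlt : ∀ n, s n < δ := fun n =>
      (hs n ▸ hM₁ (s n)).trans_le (hδ ⟨n + 1, rfl⟩)
    refine ⟨δ, ⟨⟨a, hlt 0⟩, fun γ hγ => ?_⟩, (hlt 0).le⟩
    have : ¬ γ ∈ upperBounds (Set.range s) := fun h => hmin γ h hγ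
    simp only [upperBounds, Set.mem_range, forall_exists_index, forall_apply_eq_imp_iff,
      Set.mem_ofPred_eq, not_forall, not_le] at this
    obtain ⟨n, hn⟩ := this
    exact (hM₂ (s n) γ hn.le).trans ((hs n).symm.trans_lt (hlt (n + 1)))

open Filter in
/-- Club many `δ` reflect a given `ω₁`-indexed family of functions `ω₁ → ω` to a sequence of
indices converging to `δ`. -/
theorem exists_isClub_reflecting (h : Omega1 → Omega1 → ℕ) (c : Omega1 → Omega1) :
    ∃ C : Set Omega1, IsClub C ∧ ∀ δ ∈ C, ∃ β : ℕ → Omega1, (∀ n, β n < δ) ∧ (∀ n, c (β n) < δ) ∧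
      (∀ γ < δ, ∀ᶠ n in atTop, γ < β n) ∧ ∀ x < δ, ∀ᶠ n in atTop, h (β n) x = h δ x := by
  classical
  -- Only countably many finite patterns of values live on `Iic γ`, so one countable bound `η` lies
  -- above a witness for every pattern realised beyond `γ`.
  have key : ∀ γ, ∃ η, ∀ F : Finset Omega1, (∀ x ∈ F, x ≤ γ) → ∀ α > γ,
      ∃ β, γ < β ∧ β < η ∧ c β < η ∧ ∀ x ∈ F, h β x = h α x := by
    intro γ
    have : Countable (Set.Iic γ) := (countable_Iic γ).to_subtype
    have h₁ : ∀ p : Finset (Set.Iic γ) × (Set.Iic γ →₀ ℕ), ∃ β, ∀ α > γ,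
        (∀ x ∈ p.1, h α x = p.2 x) → γ < β ∧ ∀ x ∈ p.1, h β x = p.2 x := by
      intro p
      by_cases hp : ∃ α > γ, ∀ x ∈ p.1, h α x = p.2 x
      · obtain ⟨β, hβ⟩ := hp
        exact ⟨β, fun _ _ _ => hβ⟩
      · exact ⟨γ, fun α hα hx => absurd ⟨α, hα, hx⟩ hp⟩
    choose b hb using h₁
    obtain ⟨η, hη⟩ := exists_forall_lt
      ((Set.countable_range b).union (Set.countable_range (c ∘ b)))
    refine ⟨η, fun F hF α hα => ?_⟩
    let F' : Finset (Set.Iic γ) := F.subtype (· ∈ Set.Iic γ)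
    let p : Finset (Set.Iic γ) × (Set.Iic γ →₀ ℕ) :=
      (F', Finsupp.onFinset F' (fun x => if x ∈ F' then h α x else 0) (by
        intro x hx
        by_contra hx'
        simp [hx'] at hx))
    have hp : ∀ x ∈ p.1, h α x = p.2 x := by
      intro x hx
      have hx' : x ∈ F' := hx
      simp [p, hx']
    obtain ⟨h₁, h₂⟩ := hb p α hα hp
    refine ⟨b p, h₁, hη _ (Or.inl ⟨p, rfl⟩), hη _ (Or.inr ⟨p, rfl⟩), fun x hx => ?_⟩
    have hx' : (⟨x, hF x hx⟩ : Set.Iic γ) ∈ p.1 := by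
      change _ ∈ F'
      simpa [F'] using hx
    exact (h₂ _ hx').trans (hp _ hx').symm
  choose G hG using key
  obtain ⟨C, hC, hCG⟩ := exists_isClub_closed G
  refine ⟨C, hC, fun δ hδ => ?_⟩
  obtain ⟨hne, hcl⟩ := hCG δ hδ
  obtain ⟨e, he⟩ := (countable_Iio δ).exists_eq_range hne
  have hlt : ∀ n, e n < δ := fun n => (he ▸ Set.mem_range_self n : e n ∈ Set.Iio δ)
  have hsurj : ∀ x < δ, ∃ n, e n = x := fun x hx => (he ▸ hx : x ∈ Set.range e)
  -- `F n` exhausts `δ`. As `δ` is closed under `G`, the stage `max (F n)` yields `β n < δ` beyond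
  -- that maximum whose function agrees with that of `δ` on `F n`.
  let F : ℕ → Finset Omega1 := fun n => (Finset.range (n + 1)).image e
  have hFne : ∀ n, (F n).Nonempty := fun n => ⟨e 0, by simp [F]; exact ⟨0, by simp⟩⟩
  let g : ℕ → Omega1 := fun n => (F n).max' (hFne n)
  have hgδ : ∀ n, g n < δ := by
    intro n
    have := (F n).max'_mem (hFne n)
    simp only [F, Finset.mem_image] at this
    obtain ⟨i, _, hi⟩ := this
    exact hi.symm.trans_lt (hlt i)
  have hF : ∀ n, ∀ x ∈ F n, x ≤ g n := fun n x hx => (F n).le_max' x hx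
  choose β hβ₁ hβ₂ hβ₃ hβ₄ using fun n => hG (g n) (F n) (hF n) δ (hgδ n)
  have hmem : ∀ x < δ, ∀ᶠ n in atTop, x ∈ F n := by
    intro x hx
    obtain ⟨m, rfl⟩ := hsurj x hx
    filter_upwards [eventually_ge_atTop m] with n hn
    exact Finset.mem_image_of_mem e (Finset.mem_range.2 (by omega))
  refine ⟨β, fun n => (hβ₂ n).trans (hcl _ (hgδ n)), fun n => (hβ₃ n).trans (hcl _ (hgδ n)),
    fun γ hγ => ?_, fun x hx => ?_⟩
  · filter_upwards [hmem γ hγ] with n hn using (hF n γ hn).trans_lt (hβ₁ n)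
  · filter_upwards [hmem x hx] with n hn using hβ₄ n x hn

end Omega1

/-- `Q` is coded by a rank `b : Q → ω₁` and a function `H : Q → (ω₁ → ω)` in such a way that
bounds on the rank and on the function below that rank yield bounds in `Q`. -/
def IsOmega1Coding {Q : Type*} [PartialOrder Q] (b : Q → Omega1) (H : Q → Omega1 → ℕ) : Prop :=
  ∀ (α : Omega1) (g : Omega1 → ℕ), ∃ q', ∀ q, b q ≤ α → (∀ y ≤ α, H q y ≤ g y) → q ≤ q'

namespace IsOmega1Coding

variable {Q : Type*} [PartialOrder Q] {b : Q → Omega1} {H : Q → Omega1 → ℕ}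

/-- Only finitely many ranks lie in a given finite set. For each, the second coordinate bounds the
code on the whole initial segment, and directedness joins the resulting bounds. -/
theorem tukeyLE [IsDirectedOrder Q] (hQ : IsOmega1Coding b H) : Q ≤ₜ FinOmega1 × OmegaOmega := by
  obtain ⟨e, c, hec⟩ := Omega1.exists_enum
  choose D hD using hQ
  have : Nonempty Q := ⟨D (Classical.arbitrary _) 0⟩
  classical
  refine .of_bdd (fun q => ({b q}, fun n => H q (e (b q) n))) fun ⟨F, g⟩ => ?_
  obtain ⟨M, hM⟩ := (F.image fun α => D α fun y => g (c α y)).exists_le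
  refine ⟨M, fun q hq => ?_⟩
  have hF : b q ∈ F := Finset.singleton_subset_iff.1 hq.1
  refine le_trans (hD (b q) (fun y => g (c (b q) y)) q le_rfl fun y hy => ?_)
    (hM _ (Finset.mem_image_of_mem _ hF))
  have := hq.2 (c (b q) y)
  simpa only [hec _ y hy] using this

open Filter in
theorem exists_bound_seq (hQ : IsOmega1Coding b H) {δ : Omega1} {q : ℕ → Q}
    (hb : ∀ n, b (q n) ≤ δ) (hδ : ∀ n, H (q n) δ = 0)
    (hconst : ∀ x < δ, ∃ k, ∀ᶠ n in atTop, H (q n) x = k) : ∃ q', ∀ n, q n ≤ q' := by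
  have hbd : ∀ y, ∃ k, y ≤ δ → ∀ n, H (q n) y ≤ k := by
    intro y
    by_cases hy : y ≤ δ
    · obtain hy | rfl := hy.lt_or_eq
      · obtain ⟨k, hk⟩ := hconst y hy
        obtain ⟨N, hN⟩ := eventually_atTop.1 hk
        refine ⟨k + ∑ i ∈ Finset.range N, H (q i) y, fun _ n => ?_⟩
        by_cases hn : N ≤ n
        · rw [hN n hn]; omega
        · have := Finset.single_le_sum (f := fun i => H (q i) y) (fun i _ => Nat.zero_le _)
            (Finset.mem_range.2 (not_le.1 hn))
          omega
      · exact ⟨0, fun _ n => (hδ n).le⟩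
    · exact ⟨0, fun h => absurd h hy⟩
  choose g hg using hbd
  obtain ⟨q', hq'⟩ := hQ δ g
  exact ⟨q', fun n => hq' _ (hb n) fun y hy => hg y hy n⟩

/-- If the codes vanish on their ranks stationarily often, then some infinite subset of any
`ω₁`-indexed family is bounded, so `[ω₁]^{<ω}` is not a Tukey quotient. -/
theorem not_finOmega1_le (hQ : IsOmega1Coding b H)
    (hC : ∀ C : Set Omega1, IsClub C → ∃ δ ∈ C, ∀ q, b q < δ → H q δ = 0) :
    ¬ (FinOmega1 ≤ₜ Q) := by
  intro hle
  obtain ⟨ψ, hψ⟩ := hle.exists_bdd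
  obtain ⟨C, hclub, hCr⟩ := Omega1.exists_isClub_reflecting
    (fun α => H (ψ {α})) (fun α => b (ψ {α}))
  obtain ⟨δ, hδC, hδ⟩ := hC C hclub
  obtain ⟨β, hβδ, hbβ, hlim, hconst⟩ := hCr δ hδC
  obtain ⟨q', hq'⟩ := hQ.exists_bound_seq (q := fun n => ψ {β n}) (fun n => (hbβ n).le)
    (fun n => hδ _ (hbβ n)) (fun x hx => ⟨_, hconst x hx⟩)
  obtain ⟨F, hF⟩ := hψ q'
  have hmem : ∀ n, β n ∈ F := fun n => Finset.singleton_subset_iff.1 (hF _ (hq' n))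
  -- The `β n` all lie in the finite set `F` but are cofinal in `δ`, so no element of `F` below `δ`
  -- can be maximal.
  obtain ⟨m, hm⟩ := (F.finite_toSet.inter_of_left (Set.Iio δ)).exists_maximal ⟨β 0, hmem 0, hβδ 0⟩
  obtain ⟨n, hn⟩ := (hlim m hm.prop.2).exists
  exact hn.not_ge (hm.le_of_ge ⟨hmem n, hβδ n⟩ hn.le)

end IsOmega1Coding

/-! ### The poset `Σ(ω^{ω₁})` -/

namespace SigmaOmega1

/-- A bound for the support. -/
noncomputable def rank (f : SigmaOmega1) : Omega1 := f.2.choose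

theorem rank_spec (f : SigmaOmega1) {β : Omega1} (h : rank f ≤ β) : f.1 β = 0 :=
  f.2.choose_spec β h

instance : IsDirectedOrder SigmaOmega1 := by
  refine ⟨fun f g => ⟨⟨f.1 ⊔ g.1, rank f ⊔ rank g, fun β hβ => ?_⟩, ?_, ?_⟩⟩
  · have h := sup_le_iff.1 hβ
    simp [rank_spec f h.1, rank_spec g h.2]
  · exact (le_sup_left : f.1 ≤ f.1 ⊔ g.1)
  · exact (le_sup_right : g.1 ≤ f.1 ⊔ g.1)

theorem isOmega1Coding : IsOmega1Coding rank (fun f : SigmaOmega1 => f.1) := by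
  classical
  intro α g
  obtain ⟨α', hα'⟩ := exists_gt α
  refine ⟨⟨fun y => if y ≤ α then g y else 0, α', fun β hβ => ?_⟩, fun f hf hg => ?_⟩
  · simp [(hα'.trans_le hβ).not_ge]
  · intro y
    by_cases hy : y ≤ α
    · simpa [hy] using hg y hy
    · simpa [hy] using rank_spec f (hf.trans (not_le.1 hy).le)

theorem not_finOmega1_le : ¬ (FinOmega1 ≤ₜ SigmaOmega1) :=
  isOmega1Coding.not_finOmega1_le fun _ hC =>
    hC.nonempty.imp fun _ h => ⟨h, fun q hq => rank_spec q hq.le⟩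

theorem tukeyLT : SigmaOmega1 <ₜ FinOmega1 × OmegaOmega :=
  ⟨isOmega1Coding.tukeyLE, fun h => not_finOmega1_le (TukeyLE.fst.trans h)⟩

/-- The ordinal is stored as the indicator of its initial segment, recovered from the support bound,
and the function is stored on a fixed countable set. -/
theorem prod_omegaOmega_le : Omega1 × OmegaOmega ≤ₜ SigmaOmega1 := by
  classical
  let e := Infinite.natEmbedding Omega1
  have hfin : ∀ p : Omega1 × OmegaOmega, ∃ α, ∀ β, α ≤ β →
      max (if β ≤ p.1 then 1 else 0) (Function.extend e p.2 0 β) = 0 := by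
    intro p
    obtain ⟨α, hα⟩ := Omega1.exists_forall_lt
      ((Set.countable_singleton p.1).union (Set.countable_range e))
    refine ⟨α, fun β hβ => ?_⟩
    have h₁ : ¬ β ≤ p.1 := ((hα _ (Or.inl rfl)).trans_le hβ).not_ge
    have h₂ : ¬ ∃ n, e n = β := by
      rintro ⟨n, rfl⟩
      exact (hα _ (Or.inr ⟨n, rfl⟩)).not_ge hβ
    simp [h₁, Function.extend_apply' _ _ _ h₂]
  refine .of_bdd (fun p => ⟨fun β => max (if β ≤ p.1 then 1 else 0)
    (Function.extend e p.2 0 β), hfin p⟩) fun h => ⟨(rank h, fun n => h.1 (e n)), ?_⟩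
  rintro ⟨α, f⟩ hle
  have hle' : ∀ β, max (if β ≤ α then 1 else 0) (Function.extend e f 0 β) ≤ h.1 β := hle
  constructor
  · by_contra hα
    have := hle' α
    rw [rank_spec h (not_le.1 hα).le] at this
    simp at this
  · intro n
    have := (le_max_right _ _).trans (hle' (e n))
    rwa [e.injective.extend_apply] at this

end SigmaOmega1

theorem not_finOmega1_le_prod : ¬ (FinOmega1 ≤ₜ Omega1 × OmegaOmega) := fun h =>
  SigmaOmega1.not_finOmega1_le (h.trans SigmaOmega1.prod_omegaOmega_le)

/-! ### Cardinal characteristics -/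

/-- Passes from eventual to coordinatewise dominance at the price of a constant shift; there are
only countably many shifts. -/
theorem EvLE.exists_le_add {f g : OmegaOmega} (h : EvLE f g) : ∃ n, ∀ k, f k ≤ g k + n := by
  obtain ⟨N, hN⟩ := Filter.eventually_atTop.1 h
  refine ⟨∑ i ∈ Finset.range N, f i, fun k => ?_⟩
  by_cases hk : N ≤ k
  · exact (hN k hk).trans (Nat.le_add_right _ _)
  · have := Finset.single_le_sum (f := f) (fun i _ => Nat.zero_le _)
      (Finset.mem_range.2 (not_le.1 hk))
    omega

theorem exists_evLE_of_countable {B : Set OmegaOmega} (hB : B.Countable) :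
    ∃ g, ∀ f ∈ B, EvLE f g := by
  obtain rfl | hne := B.eq_empty_or_nonempty
  · exact ⟨0, by simp⟩
  obtain ⟨u, rfl⟩ := hB.exists_eq_range hne
  refine ⟨fun k => ∑ i ∈ Finset.range (k + 1), u i k, ?_⟩
  rintro _ ⟨n, rfl⟩
  filter_upwards [Filter.eventually_ge_atTop n] with k hk
  exact Finset.single_le_sum (f := fun i => u i k) (fun i _ => Nat.zero_le _)
    (Finset.mem_range.2 (by omega))

theorem not_evLE_add_one (g : OmegaOmega) : ¬ EvLE (fun n => g n + 1) g := by
  intro h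
  obtain ⟨n, hn⟩ := h.exists
  exact (Nat.lt_succ_self _).not_ge hn

theorem aleph_one_le_sInf_mk {p : Set OmegaOmega → Prop} (hne : ∃ B, p B)
    (hp : ∀ B, p B → ¬ B.Countable) :
    ℵ₁ ≤ sInf {κ | ∃ B : Set OmegaOmega, p B ∧ Cardinal.mk B = κ} := by
  obtain ⟨B₀, hB₀⟩ := hne
  refine le_csInf ⟨_, B₀, hB₀, rfl⟩ ?_
  rintro _ ⟨B, hB, rfl⟩
  rw [← Cardinal.succ_aleph0, Order.succ_le_iff, ← not_le]
  exact fun h => hp B hB (Cardinal.le_aleph0_iff_set_countable.1 h)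

theorem sInf_mk_le_aleph_one_iff {p : Set OmegaOmega → Prop} (hne : ∃ B, p B)
    (hp : ∀ B, p B → B.Nonempty) :
    sInf {κ | ∃ B : Set OmegaOmega, p B ∧ Cardinal.mk B = κ} ≤ ℵ₁ ↔
      ∃ f : Omega1 → OmegaOmega, p (Set.range f) := by
  constructor
  · intro h
    obtain ⟨B₀, hB₀⟩ := hne
    obtain ⟨B, hB, hmk⟩ := csInf_mem
      (s := {κ | ∃ B : Set OmegaOmega, p B ∧ Cardinal.mk B = κ}) ⟨_, B₀, hB₀, rfl⟩
    rw [← hmk] at h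
    have hle : Cardinal.lift.{1} (Cardinal.mk B) ≤ Cardinal.lift.{0} (Cardinal.mk Omega1) := by
      rw [Omega1.mk_eq]
      simpa using Cardinal.lift_le.{1}.2 h
    obtain ⟨i⟩ := Cardinal.lift_mk_le'.1 hle
    have : Nonempty B := (hp B hB).to_subtype
    refine ⟨fun α => (Function.invFun i α : B), ?_⟩
    have : Set.range (fun α => ((Function.invFun i α : B) : OmegaOmega)) = B := by
      rw [Set.range_comp' Subtype.val, (Function.invFun_surjective i.injective).range_eq]
      simp
    rwa [this]
  · rintro ⟨f, hf⟩
    refine le_trans (csInf_le' (Set.mem_ofPred_eq ▸ ⟨_, hf, rfl⟩ :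
      Cardinal.mk (Set.range f) ∈ {κ | ∃ B : Set OmegaOmega, p B ∧ Cardinal.mk B = κ})) ?_
    have := Cardinal.mk_range_le_lift (f := f)
    rw [Omega1.mk_eq] at this
    rw [← Cardinal.lift_le.{1}]
    simpa using this

theorem aleph_one_eq_boundingNumber_iff :
    ℵ₁ = boundingNumber ↔ ∃ f : Omega1 → OmegaOmega, ¬ ∃ g, ∀ α, EvLE (f α) g := by
  have hne : ∃ B : Set OmegaOmega, ¬ ∃ g, ∀ f ∈ B, EvLE f g :=
    ⟨Set.univ, fun ⟨g, hg⟩ => not_evLE_add_one g (hg _ trivial)⟩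
  have h₁ : ℵ₁ ≤ boundingNumber := aleph_one_le_sInf_mk hne
    fun B hB hc => hB (exists_evLE_of_countable hc)
  have h₂ : boundingNumber ≤ ℵ₁ ↔ _ := sInf_mk_le_aleph_one_iff hne (by
    intro B hB
    by_contra h
    rw [Set.not_nonempty_iff_eq_empty] at h
    exact hB ⟨0, by simp [h]⟩)
  simp only [Set.forall_mem_range] at h₂
  rw [← h₂]
  exact ⟨fun h => h.ge, fun h => h₁.antisymm h⟩

theorem aleph_one_eq_dominatingNumber_iff :
    ℵ₁ = dominatingNumber ↔ ∃ f : Omega1 → OmegaOmega, ∀ g, ∃ α, EvLE g (f α) := by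
  have hne : ∃ D : Set OmegaOmega, ∀ f, ∃ g ∈ D, EvLE f g :=
    ⟨Set.univ, fun f => ⟨f, trivial, .of_forall fun _ => le_rfl⟩⟩
  have h₁ : ℵ₁ ≤ dominatingNumber := aleph_one_le_sInf_mk hne fun D hD hc => by
    obtain ⟨g, hg⟩ := exists_evLE_of_countable hc
    obtain ⟨f, hf, hle⟩ := hD fun n => g n + 1
    refine not_evLE_add_one g ?_
    filter_upwards [hle, hg f hf] with n h₁ h₂ using h₁.trans h₂
  have h₂ : dominatingNumber ≤ ℵ₁ ↔ _ := sInf_mk_le_aleph_one_iff hne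
    fun D hD => (hD 0).imp fun _ h => h.1
  simp only [Set.exists_range_iff] at h₂
  rw [← h₂]
  exact ⟨fun h => h.ge, fun h => h₁.antisymm h⟩

/-! ### Reductions governed by `𝔟` and `𝔡`. -/

theorem not_omegaOmega_le_omega1_prod_nat : ¬ (OmegaOmega ≤ₜ Omega1 × ℕ) := by
  intro hle
  obtain ⟨φ, ψ, h⟩ := tukeyLE_iff.1 hle
  -- Countably many functions with second coordinate at most `n` have images bounded in `ω₁ × ω`,
  -- hence are themselves bounded. So each such class is bounded at every coordinate, and a diagonal
  -- function escapes all classes.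
  have hA : ∀ n k, ∃ m, ∀ f : OmegaOmega, (ψ f).2 ≤ n → f k ≤ m := by
    intro n k
    by_contra! hcon
    choose f hf₁ hf₂ using hcon
    obtain ⟨γ, hγ⟩ := Omega1.bddAbove_of_countable (Set.countable_range fun m => (ψ (f m)).1)
    have hb : ∀ m, f m ≤ φ (γ, n) := fun m => h _ _ ⟨hγ ⟨m, rfl⟩, hf₁ m⟩
    exact (hf₂ _).not_ge (hb (φ (γ, n) k) k)
  choose g hg using hA
  let f : OmegaOmega := fun n => g n n + 1
  exact (Nat.lt_succ_self _).not_ge (hg (ψ f).2 (ψ f).2 f le_rfl)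

theorem omega1_prod_nat_le_omegaOmega_iff : (Omega1 × ℕ ≤ₜ OmegaOmega) ↔ ℵ₁ = boundingNumber := by
  rw [aleph_one_eq_boundingNumber_iff]
  constructor
  · intro hle
    obtain ⟨φ, ψ, h⟩ := tukeyLE_iff.1 hle
    refine ⟨fun α => ψ (α, 0), ?_⟩
    rintro ⟨g, hg⟩
    choose n hn using fun α => (hg α).exists_le_add
    -- The countably many shifts of `g` would bound all of `ω₁`.
    obtain ⟨γ, hγ⟩ := Omega1.exists_forall_lt
      (Set.countable_range fun n => (φ fun k => g k + n).1)
    exact (hγ _ ⟨n γ, rfl⟩).not_ge (h (γ, 0) _ (hn γ)).1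
  · rintro ⟨f, hf⟩
    have h₁ : ∀ α, ∃ g, ∀ β ≤ α, EvLE (f β) g := by
      intro α
      obtain ⟨g, hg⟩ := exists_evLE_of_countable ((Omega1.countable_Iic α).image f)
      exact ⟨g, fun β hβ => hg _ ⟨β, hβ, rfl⟩⟩
    -- `f' α` dominates every earlier `f β`, so a function above `f' α` with `α > β` dominates `f
    -- β`; a `β` where `g` fails therefore bounds `α`.
    choose f' hf' using h₁
    refine .of_bdd (fun p k => max (f' p.1 k) p.2) fun g => ?_
    push Not at hf
    obtain ⟨β, hβ⟩ := hf g
    refine ⟨(β, g 0), fun ⟨α, n⟩ hle => ⟨?_, (le_max_right _ _).trans (hle 0)⟩⟩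
    by_contra hα
    refine hβ ?_
    filter_upwards [hf' α β (not_le.1 hα).le] with k hk
    exact hk.trans ((le_max_left _ _).trans (hle k))

/-- Each `q` is sent to the singleton of an index above it; a finite set of indices names finitely
many elements, which directedness bounds. -/
theorem TukeyLE.finOmega1_of_isCofinal {Q : Type*} [PartialOrder Q] [IsDirectedOrder Q]
    (c : Omega1 → Q) (hc : ∀ q, ∃ α, q ≤ c α) : Q ≤ₜ FinOmega1 := by
  classical
  have : Nonempty Q := ⟨c (Classical.arbitrary _)⟩
  choose a ha using hc
  refine .of_bdd (fun q => {a q}) fun F => ?_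
  obtain ⟨M, hM⟩ := (F.image c).exists_le
  exact ⟨M, fun q hq => (ha q).trans
    (hM _ (Finset.mem_image_of_mem c (Finset.singleton_subset_iff.1 hq)))⟩

theorem Omega1.exists_surjective {X : Type 1} [Nonempty X] (h : Cardinal.mk X ≤ ℵ₁) :
    ∃ f : Omega1 → X, Function.Surjective f := by
  rw [← Omega1.mk_eq] at h
  obtain ⟨i⟩ := h
  exact ⟨_, Function.invFun_surjective i.injective⟩

theorem nat_prod_omega1_lt : ℕ × Omega1 <ₜ FinOmega1 := by
  constructor
  · obtain ⟨c, hc⟩ := Omega1.exists_surjective (X := ℕ × Omega1) (by simp [Cardinal.mk_prod])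
    exact .finOmega1_of_isCofinal c fun q => (hc q).imp fun _ h => h.ge
  · intro h
    refine not_finOmega1_le_prod (h.trans ?_)
    exact .of_bdd (fun p => (p.2, fun _ => p.1)) fun p =>
      ⟨(p.2 0, p.1), fun q hq => ⟨hq.2 0, hq.1⟩⟩

theorem omega1_prod_nat_lt : Omega1 × ℕ <ₜ Omega1 × OmegaOmega :=
  ⟨.of_bdd (fun p => (p.1, fun _ => p.2)) fun p => ⟨(p.1, p.2 0), fun _ hq => ⟨hq.1, hq.2 0⟩⟩,
    fun h => not_omegaOmega_le_omega1_prod_nat (TukeyLE.snd.trans h)⟩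

theorem omega1_prod_omegaOmega_le_fin_iff :
    (Omega1 × OmegaOmega ≤ₜ FinOmega1) ↔ ℵ₁ = dominatingNumber := by
  rw [aleph_one_eq_dominatingNumber_iff]
  constructor
  · intro hle
    obtain ⟨φ, ψ, h⟩ := tukeyLE_iff.1 (TukeyLE.snd.trans hle : OmegaOmega ≤ₜ FinOmega1)
    obtain ⟨c, hc⟩ := Omega1.exists_surjective (X := FinOmega1) (by simp)
    refine ⟨φ ∘ c, fun g => ?_⟩
    obtain ⟨α, hα⟩ := hc (ψ g)
    exact ⟨α, .of_forall (h g (c α) hα.ge)⟩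
  · rintro ⟨f, hf⟩
    obtain ⟨c, hc⟩ := Omega1.exists_surjective (X := Omega1 × Omega1 × ℕ)
      (by simp [Cardinal.mk_prod])
    refine .finOmega1_of_isCofinal (fun α => ((c α).1, fun k => f (c α).2.1 k + (c α).2.2)) ?_
    rintro ⟨α, g⟩
    obtain ⟨β, hβ⟩ := hf g
    obtain ⟨n, hn⟩ := hβ.exists_le_add
    obtain ⟨γ, hγ⟩ := hc (α, β, n)
    refine ⟨γ, ?_⟩
    rw [hγ]
    exact ⟨le_rfl, hn⟩

/-! ### The posets `𝒦(S)` -/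

namespace Omega1

open Filter Topology

/-- A number attached to each `w ≤ y`, injectively for fixed `y`. -/
noncomputable def code : Omega1 → Omega1 → ℕ := exists_enum.choose_spec.choose

theorem finite_code_le (y : Omega1) (k : ℕ) : {w | w < y ∧ code y w ≤ k}.Finite := by
  refine ((Set.finite_Iic k).image (exists_enum.choose y)).subset ?_
  rintro w ⟨hw, hk⟩
  exact ⟨code y w, hk, exists_enum.choose_spec.choose_spec y w hw.le⟩

/-- A countable decreasing base of open neighbourhoods at `y`. -/
def basicNhd (y : Omega1) (k : ℕ) : Set Omega1 := {x | x ≤ y ∧ ∀ w < y, code y w ≤ k → w < x}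

theorem mem_basicNhd_self (y : Omega1) (k : ℕ) : y ∈ basicNhd y k := ⟨le_rfl, fun _ h _ => h⟩

theorem basicNhd_anti (y : Omega1) {k l : ℕ} (h : k ≤ l) : basicNhd y l ⊆ basicNhd y k :=
  fun _ hx => ⟨hx.1, fun w hw hk => hx.2 w hw (hk.trans h)⟩

theorem isOpen_basicNhd (y : Omega1) (k : ℕ) : IsOpen (basicNhd y k) := by
  have h₁ : Set.Iic y =
      Set.Iio (⟨Order.succ y.1, (Cardinal.isSuccLimit_omega 1).succ_lt y.2⟩ : Omega1) := by
    ext x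
    exact (Order.lt_succ_iff (a := x.1) (b := y.1)).symm
  have h₂ : basicNhd y k = Set.Iic y ∩ ⋂ w ∈ {w | w < y ∧ code y w ≤ k}, Set.Ioi w := by
    ext x
    simp [basicNhd]
  rw [h₂, h₁]
  exact isOpen_Iio.inter ((finite_code_le y k).isOpen_biInter fun w _ => isOpen_Ioi)

theorem exists_disjoint_basicNhd {A : Set Omega1} (hA : IsClosed A) {y : Omega1} (hy : y ∉ A) :
    ∃ k, Disjoint (basicNhd y k) A := by
  by_cases h : ∃ z, z < y
  · obtain ⟨z, hz, hsub⟩ := exists_Ioc_subset_of_mem_nhds (hA.isOpen_compl.mem_nhds hy) h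
    exact ⟨code y z, Set.disjoint_left.2 fun x hx => hsub ⟨hx.2 z hz le_rfl, hx.1⟩⟩
  -- Here `y` is the least element, so its basic neighbourhood is `{y}`.
  · push Not at h
    refine ⟨0, Set.disjoint_left.2 fun x hx => ?_⟩
    rwa [le_antisymm hx.1 (h x)]

theorem isCompact_Iic (α : Omega1) : IsCompact (Set.Iic α) := by
  rw [Subtype.isCompact_iff]
  have : Subtype.val '' Set.Iic α = Set.Icc 0 α.1 := by
    ext x
    constructor
    · rintro ⟨y, hy, rfl⟩
      exact ⟨zero_le, hy⟩
    · rintro ⟨_, hx⟩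
      exact ⟨⟨x, lt_of_le_of_lt hx α.2⟩, hx, rfl⟩
  rw [this]
  exact isCompact_Icc

theorem tendsto_of_le {ι : Type*} {l : Filter ι} {u : ι → Omega1} {δ : Omega1}
    (h₁ : ∀ i, u i ≤ δ) (h₂ : ∀ γ < δ, ∀ᶠ i in l, γ < u i) : Tendsto u l (𝓝 δ) :=
  tendsto_order.2 ⟨h₂, fun _ h => .of_forall fun i => (h₁ i).trans_lt h⟩

/-- `δ` is a limit point of `A ∩ δ`. -/
def IsLimitOf (A : Set Omega1) (δ : Omega1) : Prop :=
  (∃ γ, γ < δ) ∧ ∀ γ < δ, ∃ a ∈ A, γ < a ∧ a < δ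

theorem exists_isClub_isLimitOf {A : Set Omega1} (hA : ∀ γ, ∃ a ∈ A, γ < a) :
    ∃ C, IsClub C ∧ ∀ δ ∈ C, IsLimitOf A δ := by
  choose G hG₁ hG₂ using hA
  obtain ⟨C, hC, h⟩ := exists_isClub_closed G
  exact ⟨C, hC, fun δ hδ => ⟨(h δ hδ).1, fun γ hγ => ⟨G γ, hG₁ γ, hG₂ γ, (h δ hδ).2 γ hγ⟩⟩⟩

theorem exists_gt_mem_of_isStationary {S : Set Omega1} (hS : IsStationary S) (γ : Omega1) :
    ∃ a ∈ S, γ < a := by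
  obtain ⟨C, hC, h⟩ := exists_isClub_closed fun _ => γ
  obtain ⟨δ, hδS, hδC⟩ := hS hC
  obtain ⟨⟨x, hx⟩, h⟩ := h δ hδC
  exact ⟨δ, hδS, h x hx⟩

theorem IsLimitOf.exists_seq {A : Set Omega1} {δ : Omega1} (h : IsLimitOf A δ) :
    ∃ u : ℕ → Omega1, (∀ n, u n ∈ A) ∧ (∀ n, u n < δ) ∧ ∀ γ < δ, ∀ᶠ n in atTop, γ < u n := by
  obtain ⟨hne, h⟩ := h
  obtain ⟨e, he⟩ := (countable_Iio δ).exists_eq_range hne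
  have hlt : ∀ n, e n < δ := fun n => (he ▸ Set.mem_range_self n : e n ∈ Set.Iio δ)
  have hmax : ∀ n, ∃ γ < δ, ∀ i ≤ n, e i ≤ γ := by
    intro n
    induction n with
    | zero => exact ⟨e 0, hlt 0, fun i hi => by rw [Nat.le_zero.1 hi]⟩
    | succ n ih =>
      obtain ⟨γ, hγ, hle⟩ := ih
      refine ⟨max γ (e (n + 1)), max_lt hγ (hlt _), fun i hi => ?_⟩
      obtain hi | rfl := Nat.le_succ_iff.1 hi
      · exact (hle i hi).trans (le_max_left _ _)
      · exact le_max_right _ _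
  choose g hg hle using hmax
  choose u hu₁ hu₂ hu₃ using fun n => h (g n) (hg n)
  refine ⟨u, hu₁, hu₃, fun γ hγ => ?_⟩
  obtain ⟨m, rfl⟩ := (he ▸ hγ : γ ∈ Set.range e)
  filter_upwards [eventually_ge_atTop m] with n hn using (hle n m hn).trans_lt (hu₂ n)

end Omega1

/-! ### Compact subsets of `S`: coding and reductions. -/

namespace KOmega1

open Filter Topology

variable {S : Set Omega1}

/-- A compact subset of `S` as a subset of `ω₁`. -/
def toSet (K : KOmega1 S) : Set Omega1 := Subtype.val '' (K : Set S)

theorem isCompact_toSet (K : KOmega1 S) : IsCompact (toSet K) :=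
  K.isCompact.image continuous_subtype_val

theorem toSet_subset (K : KOmega1 S) : toSet K ⊆ S := Subtype.coe_image_subset S K

theorem le_iff {K L : KOmega1 S} : K ≤ L ↔ toSet K ⊆ toSet L :=
  (Set.image_subset_image_iff Subtype.val_injective).symm

theorem exists_toSet_eq {D : Set Omega1} (hD : IsCompact D) (hDS : D ⊆ S) :
    ∃ K : KOmega1 S, toSet K = D := by
  have h : Subtype.val '' (Subtype.val ⁻¹' D : Set S) = D := by
    rw [Subtype.image_preimage_coe, Set.inter_eq_right.2 hDS]
  refine ⟨⟨Subtype.val ⁻¹' D, ?_⟩, h⟩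
  rw [Subtype.isCompact_iff, h]
  exact hD

/-- An upper bound for a compact set. -/
noncomputable def rank (K : KOmega1 S) : Omega1 := (isCompact_toSet K).bddAbove.choose

theorem le_rank (K : KOmega1 S) {x : Omega1} (hx : x ∈ toSet K) : x ≤ rank K :=
  (isCompact_toSet K).bddAbove.choose_spec hx

/-- The value `0` on `S` is what makes the code vanish at stationarily many `δ`. -/
theorem exists_avoid (K : KOmega1 S) (y : Omega1) :
    ∃ k, (y ∈ S → k = 0) ∧ (y ∉ S → Disjoint (Omega1.basicNhd y k) (toSet K)) := by
  by_cases hy : y ∈ S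
  · exact ⟨0, fun _ => rfl, fun h => absurd hy h⟩
  · obtain ⟨k, hk⟩ := Omega1.exists_disjoint_basicNhd (isCompact_toSet K).isClosed
      fun h => hy (toSet_subset K h)
    exact ⟨k, fun h => absurd h hy, fun _ => hk⟩

/-- For `y ∉ S`, the index of a basic neighbourhood of `y` that misses `K`. -/
noncomputable def avoid (K : KOmega1 S) (y : Omega1) : ℕ := (exists_avoid K y).choose

theorem avoid_of_mem (K : KOmega1 S) {y : Omega1} (hy : y ∈ S) : avoid K y = 0 :=
  (exists_avoid K y).choose_spec.1 hy

theorem disjoint_avoid (K : KOmega1 S) {y : Omega1} (hy : y ∉ S) :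
    Disjoint (Omega1.basicNhd y (avoid K y)) (toSet K) :=
  (exists_avoid K y).choose_spec.2 hy

theorem isOmega1Coding : IsOmega1Coding (rank (S := S)) avoid := by
  intro α g
  -- Removing an open neighbourhood of every missing point of `Iic α` leaves a compact set inside
  -- `S`, the largest one compatible with the bounds `α` and `g`.
  let D : Set Omega1 := Set.Iic α ∩ ⋂ y ∈ Set.Iic α \ S, (Omega1.basicNhd y (g y))ᶜ
  have hD : IsCompact D := (Omega1.isCompact_Iic α).inter_right <|
    isClosed_biInter fun y _ => (Omega1.isOpen_basicNhd y _).isClosed_compl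
  have hDS : D ⊆ S := by
    intro x hx
    by_contra hxS
    exact Set.mem_iInter₂.1 hx.2 x ⟨hx.1, hxS⟩ (Omega1.mem_basicNhd_self x _)
  obtain ⟨L, hL⟩ := exists_toSet_eq hD hDS
  refine ⟨L, fun K hK hg => le_iff.2 ?_⟩
  rw [hL]
  refine fun x hx => ⟨(le_rank K hx).trans hK, Set.mem_iInter₂.2 fun y hy hxy => ?_⟩
  exact Set.disjoint_left.1 (disjoint_avoid K hy.2)
    (Omega1.basicNhd_anti y (hg y hy.1) hxy) hx

theorem not_finOmega1_le (hS : IsStationary S) : ¬ (FinOmega1 ≤ₜ KOmega1 S) :=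
  isOmega1Coding.not_finOmega1_le fun _ hC =>
    (hS hC).imp fun _ h => ⟨h.2, fun K _ => avoid_of_mem K h.1⟩

theorem tukeyLT (hS : IsStationary S) : KOmega1 S <ₜ FinOmega1 × OmegaOmega :=
  ⟨isOmega1Coding.tukeyLE, fun h => not_finOmega1_le hS (TukeyLE.fst.trans h)⟩

theorem not_le_sigmaOmega1 (hS : IsStationary S) (hS' : IsStationary Sᶜ) :
    ¬ (KOmega1 S ≤ₜ SigmaOmega1) := by
  intro hle
  obtain ⟨ψ, hψ⟩ := hle.exists_bdd
  choose s hsS hs using Omega1.exists_gt_mem_of_isStationary hS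
  choose L hL using fun α => exists_toSet_eq (S := S) (isCompact_singleton (x := s α))
    (Set.singleton_subset_iff.2 (hsS α))
  -- Including `s α` in the maximum keeps `s (β n)` below `δ`; as `s (β n) > β n`, these points
  -- converge to `δ ∉ S`.
  obtain ⟨C, hC, hCr⟩ := Omega1.exists_isClub_reflecting (fun α => (ψ (L α)).1)
    (fun α => max (s α) (SigmaOmega1.rank (ψ (L α))))
  obtain ⟨δ, hδS, hδC⟩ := hS' hC
  obtain ⟨β, -, hcβ, hlim, hconst⟩ := hCr δ hδC
  have hrank : ∀ n, SigmaOmega1.rank (ψ (L (β n))) ≤ δ := fun n =>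
    (le_max_right _ _).trans (hcβ n).le
  obtain ⟨q', hq'⟩ := SigmaOmega1.isOmega1Coding.exists_bound_seq (q := fun n => ψ (L (β n)))
    hrank (fun n => SigmaOmega1.rank_spec _ (hrank n)) (fun x hx => ⟨_, hconst x hx⟩)
  obtain ⟨M, hM⟩ := hψ q'
  have hmem : ∀ n, s (β n) ∈ toSet M := fun n =>
    le_iff.1 (hM _ (hq' n)) (by rw [hL]; rfl)
  have hlim' : Tendsto (fun n => s (β n)) atTop (𝓝 δ) :=
    Omega1.tendsto_of_le (fun n => (le_max_left _ _).trans (hcβ n).le) fun γ hγ =>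
      (hlim γ hγ).mono fun n hn => hn.trans (hs _)
  exact hδS (toSet_subset M
    ((isCompact_toSet M).isClosed.mem_of_tendsto hlim' (.of_forall hmem)))

/-- A stationary, co-stationary set contains a point `s` which is the limit of points `x n` of the
complement, each the limit of a sequence `u n` in the set, with the sequences `u n` converging
uniformly to `s`. -/
theorem exists_fan (hS : IsStationary S) (hS' : IsStationary Sᶜ) :
    ∃ s ∈ S, ∃ (x : ℕ → Omega1) (u : ℕ → ℕ → Omega1), (∀ n, x n ∉ S) ∧ (∀ n k, u n k ∈ S) ∧
      (∀ n, Tendsto (u n) atTop (𝓝 (x n))) ∧ (∀ n k, u n k ≤ s) ∧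
      ∀ γ < s, ∀ᶠ n in atTop, ∀ k, γ < u n k := by
  have hX : ∀ γ, ∃ x ∈ {x | x ∉ S ∧ Omega1.IsLimitOf S x}, γ < x := by
    intro γ
    -- Restricting to points beyond `γ` forces the limit `x` itself beyond `γ`.
    obtain ⟨C, hC, hlim⟩ := Omega1.exists_isClub_isLimitOf (A := S ∩ Set.Ioi γ) fun η => by
      obtain ⟨a, ha, hlt⟩ := Omega1.exists_gt_mem_of_isStationary hS (max η γ)
      exact ⟨a, ⟨ha, (le_max_right _ _).trans_lt hlt⟩, (le_max_left _ _).trans_lt hlt⟩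
    obtain ⟨x, hxS, hxC⟩ := hS' hC
    obtain ⟨⟨η, hη⟩, h⟩ := hlim x hxC
    refine ⟨x, ⟨hxS, ⟨η, hη⟩, fun ξ hξ => ?_⟩, ?_⟩
    · obtain ⟨a, ha, h₁, h₂⟩ := h ξ hξ
      exact ⟨a, ha.1, h₁, h₂⟩
    · obtain ⟨a, ha, h₁, h₂⟩ := h η hη
      exact lt_trans ha.2 h₂
  obtain ⟨C, hC, hlim⟩ := Omega1.exists_isClub_isLimitOf hX
  obtain ⟨s, hsS, hsC⟩ := hS hC
  obtain ⟨v, -, hv, hvlim⟩ := (hlim s hsC).exists_seq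
  choose x hxX hvx hxs using fun n => (hlim s hsC).2 (v n) (hv n)
  have hx : ∀ n, Omega1.IsLimitOf (S ∩ Set.Ioi (v n)) (x n) := fun n => by
    refine ⟨⟨v n, hvx n⟩, fun γ hγ => ?_⟩
    obtain ⟨a, ha, h₁, h₂⟩ := (hxX n).2.2 (max γ (v n)) (max_lt hγ (hvx n))
    exact ⟨a, ⟨ha, (le_max_right _ _).trans_lt h₁⟩, (le_max_left _ _).trans_lt h₁, h₂⟩
  choose u hu₁ hu₂ hu₃ using fun n => (hx n).exists_seq
  refine ⟨s, hsS, x, u, fun n => (hxX n).1, fun n k => (hu₁ n k).1,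
    fun n => Omega1.tendsto_of_le (fun k => (hu₂ n k).le) (hu₃ n),
    fun n k => ((hu₂ n k).trans (hxs n)).le, fun γ hγ => ?_⟩
  filter_upwards [hvlim γ hγ] with n hn k using hn.trans (hu₁ n k).2

/-- A function `f` is coded by `s` with the points `u n k`, `k ≤ f n`, compact because each `n`
contributes finitely many points and they converge to `s`. Conversely a compact `K ⊆ S` misses `x
n`, so contains `u n k` only for boundedly many `k`. The extra point `t α` records the ordinal. -/
theorem prod_omegaOmega_le (hS : IsStationary S) (hS' : IsStationary Sᶜ) :
    Omega1 × OmegaOmega ≤ₜ KOmega1 S := by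
  obtain ⟨s, hs, x, u, hxS, huS, hux, hus, hlim⟩ := exists_fan hS hS'
  choose t htS ht using Omega1.exists_gt_mem_of_isStationary hS
  have hK : ∀ p : Omega1 × OmegaOmega, ∃ K : KOmega1 S,
      t p.1 ∈ toSet K ∧ ∀ n, u n (p.2 n) ∈ toSet K := by
    rintro ⟨α, f⟩
    have htend : Tendsto (fun i : Σ n, Fin (f n + 1) => u i.1 i.2) cofinite (𝓝 s) := by
      refine Omega1.tendsto_of_le (fun i => hus _ _) fun γ hγ => ?_
      obtain ⟨N, hN⟩ := eventually_atTop.1 (hlim γ hγ)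
      refine (Set.finite_range fun j : Σ n : Fin N, Fin (f n + 1) =>
        (⟨j.1, j.2⟩ : Σ n, Fin (f n + 1))).subset fun i hi => ?_
      have h : i.1 < N := by
        by_contra h
        exact hi (hN i.1 (not_lt.1 h) i.2)
      exact ⟨⟨⟨i.1, h⟩, i.2⟩, rfl⟩
    obtain ⟨K, hK⟩ := exists_toSet_eq (S := S)
      (htend.isCompact_insert_range_of_cofinite.insert (t α)) (by
        rintro _ (rfl | rfl | ⟨i, rfl⟩)
        exacts [htS α, hs, huS _ _])
    refine ⟨K, ?_, fun n => ?_⟩ <;> rw [hK]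
    · exact Or.inl rfl
    · exact Or.inr (Or.inr ⟨⟨n, Fin.last _⟩, rfl⟩)
  choose ψ hψ₁ hψ₂ using hK
  refine .of_bdd ψ fun K => ?_
  have hN : ∀ n, ∃ N, ∀ k, N ≤ k → u n k ∉ toSet K := fun n =>
    eventually_atTop.1 ((hux n).eventually ((isCompact_toSet K).isClosed.isOpen_compl.mem_nhds
      fun h => hxS n (toSet_subset K h)))
  choose N hN using hN
  refine ⟨(rank K, N), fun p hp => ⟨?_, fun n => ?_⟩⟩
  · exact (ht p.1).le.trans (le_rank K (le_iff.1 hp (hψ₁ p)))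
  · by_contra h
    exact hN n _ (not_le.1 h).le (le_iff.1 hp (hψ₂ p n))

theorem prod_omegaOmega_lt (hS : IsStationary S) (hS' : IsStationary Sᶜ) :
    Omega1 × OmegaOmega <ₜ KOmega1 S :=
  ⟨prod_omegaOmega_le hS hS', fun h =>
    not_le_sigmaOmega1 hS hS' (h.trans SigmaOmega1.prod_omegaOmega_le)⟩

end KOmega1

theorem mainTheorem7 :
    -- (a)
    (Omega1 × ℕ <ₜ Omega1 × OmegaOmega) ∧
    -- (b)
    (ℕ × Omega1 <ₜ FinOmega1) ∧
    -- (c)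
    (¬ (OmegaOmega ≤ₜ Omega1 × ℕ) ∧ ((Omega1 × ℕ <ₜ OmegaOmega) ↔ ℵ₁ = boundingNumber)) ∧
    -- (d)
    (¬ (FinOmega1 ≤ₜ Omega1 × OmegaOmega) ∧
      ((Omega1 × OmegaOmega <ₜ FinOmega1) ↔ ℵ₁ = dominatingNumber)) ∧
    -- (e)
    ((Omega1 × OmegaOmega ≤ₜ SigmaOmega1) ∧ (SigmaOmega1 <ₜ FinOmega1 × OmegaOmega)) ∧
    -- (f)
    (∀ S : Set Omega1, IsStationary S → IsStationary Sᶜ →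
      (Omega1 × OmegaOmega <ₜ KOmega1 S) ∧ (KOmega1 S <ₜ FinOmega1 × OmegaOmega)) ∧
    -- (g)
    (∀ S : Set Omega1, IsStationary S → IsStationary Sᶜ →
      ¬ (KOmega1 S ≤ₜ SigmaOmega1)) := by
  refine ⟨omega1_prod_nat_lt, nat_prod_omega1_lt, ⟨not_omegaOmega_le_omega1_prod_nat, ?_⟩,
    ⟨not_finOmega1_le_prod, ?_⟩, ⟨SigmaOmega1.prod_omegaOmega_le, SigmaOmega1.tukeyLT⟩,
    fun S hS hS' => ⟨KOmega1.prod_omegaOmega_lt hS hS', KOmega1.tukeyLT hS⟩,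
    fun S hS hS' => KOmega1.not_le_sigmaOmega1 hS hS'⟩
  · rw [← omega1_prod_nat_le_omegaOmega_iff]
    exact ⟨fun h => h.1, fun h => ⟨h, not_omegaOmega_le_omega1_prod_nat⟩⟩
  · rw [← omega1_prod_omegaOmega_le_fin_iff]
    exact ⟨fun h => h.1, fun h => ⟨h, not_finOmega1_le_prod⟩⟩
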